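/- Let $\mathcal X$ be a finite set, $\mu$ a probability distribution on $\mathcal X$, and $g:\mathcal X\to\mathbb R$. Let $r=(r_t(y,x))_{t\in[0,1]}$ be transition rates on $\mathcal X$ (from $x$ to $y$), that is, $r_t(y,x)\ge 0$ for $y\ne x$ and $\sum_y r_t(y,x)=0$, integrable in $t\in[0,1]$, and let $p^r$ be the path measure (law on càdlàg paths $[0,1]\to\mathcal X$) of the continuous-time Markov chain (CTMC) with rates $r$ and initial distribution $\mu$. A control is a family of transition rates $u=(u_t(y,x))_{t\in[0,1]}$ together with a path measure $p^u$ of a CTMC with rates $u$, initial distribution $\mu$ and $\mathbb E_{X\sim p^u}\int_0^1|u_t(y,X_t)|\,\mathrm dt<\infty$ for all $y$. (A CTMC with rates $u$ is a Markov process whose transition probabilities satisfy the Kolmogorov forward equation, in integrated form.) Consider the two problems over controls $$\text{(SOC)}\quad \min_{u}\Big\{\mathrm{KL}(p^u\|p^r)+\mathbb E_{X\sim p^u}\,g(X_1)\Big\},\qquad\qquad \text{(SB)}\quad \min_{u:\ p^u_1=\nu}\mathrm{KL}(p^u\|p^r),$$ where $p^u_1$ is the law of $X_1$ under $p^u$ and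 $$\nu(x)=\mathrm e^{-g(x)}\sum_{y} p^r_{1|0}(x|y)\,\frac{\mu(y)}{Z(y)},\qquad Z(y)=\mathbb E_{p^r_{1|0}(\cdot|y)}\mathrm e^{-g}=\sum_x p^r_{1|0}(x|y)\,\mathrm e^{-g(x)},$$ with $p^r_{1|0}(x|y)=p^r(X_1=x\mid X_0=y)$ (terms with $\mu(y)=0$ are zero). Then (SOC) with terminal cost $g$ is equivalent to (SB) with terminal distribution $\nu$: $\nu$ is a probability distribution; a control solves (SOC) if and only if it solves (SB); solutions exist; and every solution has the same path measure $p^\star$, given by $$\frac{\mathrm dp^\star}{\mathrm dp^r}(X)=\frac{\mathrm e^{-g(X_1)}}{Z(X_0)}.$$ -/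

import Mathlib

noncomputable section

namespace CTMC

open MeasureTheory ProbabilityTheory

/-- Right-continuous paths with left limits from `[0,1]` to the (discrete, finite) set `X`. -/
def PathSpace (X : Type*) : Type _ :=
  {ω : unitInterval → X //
    (∀ t, ∀ᶠ s in nhdsWithin t (Set.Ioi t), ω s = ω t) ∧
    (∀ t, ∃ x, ∀ᶠ s in nhdsWithin t (Set.Iio t), ω s = x)}

/-- The position `X_t` of a path at time `t ∈ [0,1]`. For convenience the time is a real number;
it is only ever used in `[0,1]`, where the projection does nothing. -/
def pos {X : Type*} (t : ℝ) (ω : PathSpace X) : X :=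
  ω.1 (Set.projIcc (0 : ℝ) 1 zero_le_one t)

/-- The sigma-algebra on path space generated by all positions. -/
instance pathMeasurableSpace (X : Type*) : MeasurableSpace (PathSpace X) :=
  ⨆ t ∈ Set.Icc (0 : ℝ) 1, MeasurableSpace.comap (pos t) ⊤

/-- The sigma-algebra generated by the positions up to time `s`. -/
abbrev past (X : Type*) (s : ℝ) : MeasurableSpace (PathSpace X) :=
  ⨆ t ∈ Set.Icc (0 : ℝ) s, MeasurableSpace.comap (pos t) ⊤

/-- The event `X_t = x`. -/
def at_ {X : Type*} (t : ℝ) (x : X) : Set (PathSpace X) := {ω | pos t ω = x}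

/-- `P` is the path measure of a continuous-time Markov chain on `[0,1]` with transition rate
`u t y x` (rate from `x` to `y` at time `t`) and initial distribution `mu`. The transition
probabilities solve the Kolmogorov forward equation, integrated in time and written with
joint instead of conditional probabilities, so that states of probability zero need no convention.
The integrability condition says that the expected total jump rate along the chain is finite. -/
structure IsCTMC {X : Type*} [Fintype X] (mu : X → ℝ) (u : ℝ → X → X → ℝ)
    (P : Measure (PathSpace X)) : Prop where
  rate_nonneg : ∀ t ∈ Set.Icc (0 : ℝ) 1, ∀ x y, y ≠ x → 0 ≤ u t y x
  rate_sum : ∀ t ∈ Set.Icc (0 : ℝ) 1, ∀ x, ∑ y, u t y x = 0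
  isProbabilityMeasure : IsProbabilityMeasure P
  initial : ∀ x, P.real (at_ 0 x) = mu x
  markov : ∀ s t : ℝ, 0 ≤ s → s ≤ t → t ≤ 1 → ∀ A, MeasurableSet[past X s] A → ∀ x y,
    P.real (A ∩ at_ s x ∩ at_ t y) * P.real (at_ s x) =
      P.real (A ∩ at_ s x) * P.real (at_ s x ∩ at_ t y)
  integrable : ∀ x y, IntegrableOn (fun t => u t y x * P.real (at_ t x)) (Set.Icc (0 : ℝ) 1)
  forward : ∀ s t : ℝ, 0 ≤ s → s ≤ t → t ≤ 1 → ∀ x y,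
    P.real (at_ s x ∩ at_ t y) = P.real (at_ s x ∩ at_ s y) +
      ∫ τ in s..t, ∑ z, u τ y z * P.real (at_ s x ∩ at_ τ z)

/-- The objective of the stochastic optimal control problem with terminal cost `g`:
`KL(P ‖ Pr) + E_P g(X_1)`, possibly `+∞`. -/
def socCost {X : Type*} (Pr : Measure (PathSpace X)) (g : X → ℝ) (P : Measure (PathSpace X)) :
    EReal :=
  ((InformationTheory.klDiv P Pr : ENNReal) : EReal) + ((∫ ω, g (pos 1 ω) ∂P : ℝ) : EReal)

/-- The transition rate `u`, with path measure `P`, solves the stochastic optimal control problem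
with reference path measure `Pr`, initial distribution `mu` and terminal cost `g`. -/
def SolvesSOC {X : Type*} [Fintype X] (mu : X → ℝ) (Pr : Measure (PathSpace X)) (g : X → ℝ)
    (u : ℝ → X → X → ℝ) (P : Measure (PathSpace X)) : Prop :=
  IsCTMC mu u P ∧ ∀ u' P', IsCTMC mu u' P' → socCost Pr g P ≤ socCost Pr g P'

/-- The transition rate `u`, with path measure `P`, solves the Schrödinger bridge problem with
reference path measure `Pr`, initial distribution `mu` and terminal distribution `nu`. -/
def SolvesSB {X : Type*} [Fintype X] (mu : X → ℝ) (Pr : Measure (PathSpace X)) (nu : X → ℝ)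
    (u : ℝ → X → X → ℝ) (P : Measure (PathSpace X)) : Prop :=
  IsCTMC mu u P ∧ (∀ x, P.real (at_ 1 x) = nu x) ∧
    ∀ u' P', IsCTMC mu u' P' → (∀ x, P'.real (at_ 1 x) = nu x) →
      InformationTheory.klDiv P Pr ≤ InformationTheory.klDiv P' Pr

/-- The conditional probability `p_{1|0}(x|y) = P(X_1 = x | X_0 = y)`. It is `0` when `X_0 = y` has
probability zero; below, such `y` are always weighted by `0`. -/
def trans01 {X : Type*} (P : Measure (PathSpace X)) (x y : X) : ℝ :=
  (cond P (at_ 0 y)).real (at_ 1 x)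

/-- `Z(y)`, the expectation of `e^{-g}` under `p_{1|0}(·|y)`. -/
def partitionFn {X : Type*} [Fintype X] (Pr : Measure (PathSpace X)) (g : X → ℝ) (y : X) : ℝ :=
  ∑ x, trans01 Pr x y * Real.exp (-g x)

/-- `ν(x) = e^{-g(x)} ∑_y p_{1|0}(x|y) μ(y) / Z(y)`. -/
def terminalLaw {X : Type*} [Fintype X] (mu : X → ℝ) (Pr : Measure (PathSpace X)) (g : X → ℝ)
    (x : X) : ℝ :=
  Real.exp (-g x) * ∑ y, trans01 Pr x y * (mu y / partitionFn Pr g y)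

end CTMC

end

namespace CTMC

open MeasureTheory Set Filter Topology

/-! ### Absolutely continuous functions on an interval -/

/-! Let `gibbs` be the path measure with density `e^{-g(X_1)} / Z(X_0)`. Taking logarithms of
densities gives, for every `P` with initial law `mu`, KL(P‖Pr) = KL(P‖gibbs) - ∑ mu log Z - E_P
g(X_1) (`klDiv_eq_klDiv_gibbs_add`). Hence the SOC cost is KL(P‖gibbs) plus a constant. Under the
constraint P_1 = ν the term E_P g(X_1) is constant too, so the SB cost is also KL(P‖gibbs) plus a
constant. Relative entropy vanishes only at equality, so both problems have `gibbs` as their only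
optimal path measure, provided that it is feasible.

Its endpoint laws `mu` and ν are direct computations. The analytic work is to show that `gibbs` is
the law of a chain (`exists_isCTMC_endpointReweight`). Let `h` solve the backward equation with
terminal value `e^{-g}`; it exists by a fixed point argument that needs only integrable rates
(`exists_backward_solution`). By Feynman-Kac and the Markov property, `gibbs` has density `h(t, X_t)
/ Z(X_0)` on the past of `t`. The product rule for the transition probabilities times `h` then
yields the forward equation with Doob's rates `r(y,x) h(y) / h(x)`.

Null states need care: positivity of `h` is derived only at states of positive probability. The
rates therefore use positive parts, and the flux into null states is shown to vanish for almost
every time. -/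

theorem absolutelyContinuousOnInterval_exp_comp {F : ℝ → ℝ} {a b : ℝ}
    (hF : AbsolutelyContinuousOnInterval F a b) :
    AbsolutelyContinuousOnInterval (fun t => Real.exp (F t)) a b := by
  obtain ⟨C, hC⟩ := hF.exists_bound
  -- `exp` is Lipschitz with constant `exp C` on `(-∞, C]`, and `C` bounds `F` on the interval.
  have hlip : ∀ x ∈ uIcc a b, ∀ y ∈ uIcc a b,
      dist (Real.exp (F x)) (Real.exp (F y)) ≤ Real.exp C * dist (F x) (F y) := by
    have key : ∀ p q : ℝ, p ≤ C → q ≤ p →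
        |Real.exp p - Real.exp q| ≤ Real.exp C * |p - q| := by
      intro p q hp hq
      rw [abs_of_nonneg (sub_nonneg.2 (Real.exp_le_exp.2 hq)), abs_of_nonneg (sub_nonneg.2 hq)]
      have h1 : Real.exp q = Real.exp p * Real.exp (q - p) := by
        rw [← Real.exp_add]; congr 1; ring
      have h2 := Real.add_one_le_exp (q - p)
      have h3 := Real.exp_pos p
      have h4 := Real.exp_le_exp.2 hp
      nlinarith [mul_le_mul_of_nonneg_left h2 h3.le,
        mul_le_mul_of_nonneg_right h4 (sub_nonneg.2 hq)]
    intro x hx y hy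
    have h1 := (abs_le.1 (hC x hx)).2
    have h2 := (abs_le.1 (hC y hy)).2
    rw [Real.dist_eq, Real.dist_eq]
    rcases le_total (F y) (F x) with h | h
    · exact key _ _ h1 h
    · rw [abs_sub_comm, abs_sub_comm (F x)]
      exact key _ _ h2 h
  rw [absolutelyContinuousOnInterval_iff] at hF ⊢
  intro ε hε
  obtain ⟨δ, hδ, h⟩ := hF (ε / Real.exp C) (div_pos hε (Real.exp_pos C))
  refine ⟨δ, hδ, fun E hE hsum => ?_⟩
  refine lt_of_le_of_lt (Finset.sum_le_sum fun i hi => ?_)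
    (b := ∑ i ∈ Finset.range E.1, Real.exp C * dist (F (E.2 i).1) (F (E.2 i).2)) ?_
  · exact hlip _ (hE.1 i hi).1 _ (hE.1 i hi).2
  · rw [← Finset.mul_sum]
    have := h E hE hsum
    rwa [lt_div_iff₀' (Real.exp_pos C)] at this

/-- The product rule in integrated form. -/
theorem mul_sub_mul_eq_integral {F G f g : ℝ → ℝ} {a b : ℝ} (hab : a ≤ b)
    (hf : IntervalIntegrable f volume a b) (hg : IntervalIntegrable g volume a b)
    (hF : ∀ t ∈ Icc a b, F t = F a + ∫ τ in a..t, f τ)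
    (hG : ∀ t ∈ Icc a b, G t = G a + ∫ τ in a..t, g τ) :
    F b * G b - F a * G a = ∫ τ in a..b, (f τ * G τ + F τ * g τ) := by
  have acF := hf.absolutelyContinuousOnInterval_intervalIntegral (c := a) left_mem_uIcc
  have acG := hg.absolutelyContinuousOnInterval_intervalIntegral (c := a) left_mem_uIcc
  have cF : AbsolutelyContinuousOnInterval (fun _ : ℝ => F a) a b :=
    (LipschitzWith.const (F a)).lipschitzOnWith.absolutelyContinuousOnInterval (K := 0)
  have cG : AbsolutelyContinuousOnInterval (fun _ : ℝ => G a) a b :=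
    (LipschitzWith.const (G a)).lipschitzOnWith.absolutelyContinuousOnInterval (K := 0)
  have key := ((cF.fun_add acF).fun_mul (cG.fun_add acG)).integral_deriv_eq_sub
  rw [← hF b (right_mem_Icc.2 hab), ← hG b (right_mem_Icc.2 hab)] at key
  simp only [intervalIntegral.integral_same, add_zero] at key
  rw [← key]
  refine intervalIntegral.integral_congr_ae ?_
  filter_upwards [hf.ae_hasDerivAt_integral, hg.ae_hasDerivAt_integral] with τ h1 h2 hτ
  have hτ' := uIoc_subset_uIcc hτ
  have d1 := (h1 hτ' a left_mem_uIcc).const_add (F a)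
  have d2 := (h2 hτ' a left_mem_uIcc).const_add (G a)
  have hm : τ ∈ Icc a b := by rwa [uIcc_of_le hab] at hτ'
  rw [(d1.fun_mul d2).deriv, ← hF τ hm, ← hG τ hm]

/-- The derivative of a nonnegative primitive vanishes almost everywhere on its zero set. -/
theorem ae_eq_zero_of_primitive_eq_zero {F f : ℝ → ℝ} {a b : ℝ} (hab : a ≤ b)
    (hf : IntervalIntegrable f volume a b)
    (hF : ∀ t ∈ Icc a b, F t = F a + ∫ τ in a..t, f τ) (h0 : ∀ t ∈ Icc a b, 0 ≤ F t) :
    ∀ᵐ t, t ∈ Icc a b → F t = 0 → f t = 0 := by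
  filter_upwards [hf.ae_hasDerivAt_integral, Measure.ae_ne volume a,
    Measure.ae_ne volume b] with t h1 ha hb ht hFt
  have hmem : Icc a b ∈ 𝓝 t :=
    Icc_mem_nhds (lt_of_le_of_ne ht.1 (Ne.symm ha)) (lt_of_le_of_ne ht.2 hb)
  have hd : HasDerivAt F (f t) t := by
    refine ((h1 (by rwa [uIcc_of_le hab]) a left_mem_uIcc).const_add
      (F a)).congr_of_eventuallyEq ?_
    filter_upwards [hmem] with x hx using hF x hx
  refine IsLocalMin.hasDerivAt_eq_zero ?_ hd
  filter_upwards [hmem] with x hx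
  rw [hFt]
  exact h0 x hx

/-! ### The linear backward equation with integrable coefficients -/

/-- The integrand is `-1/2` times the a.e. derivative of the exponential. The factor 2 in the
exponent becomes the contraction constant 1/2 of the backward operator. -/
theorem integral_mul_exp_primitive {k : ℝ → ℝ} {t b : ℝ}
    (hk : IntervalIntegrable k volume t b) :
    ∫ τ in t..b, k τ * Real.exp (2 * ∫ σ in τ..b, k σ) =
      (Real.exp (2 * ∫ σ in t..b, k σ) - 1) / 2 := by
  have ac := (hk.absolutelyContinuousOnInterval_intervalIntegral (c := b) right_mem_uIcc).const_mul
    (-2)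
  have key := (absolutelyContinuousOnInterval_exp_comp ac).integral_deriv_eq_sub
  have hrev : ∀ τ, -2 * ∫ σ in b..τ, k σ = 2 * ∫ σ in τ..b, k σ := by
    intro τ; rw [intervalIntegral.integral_symm b τ]; ring
  simp only [hrev] at key
  have h2 : ∫ τ in t..b, deriv (fun τ => Real.exp (2 * ∫ σ in τ..b, k σ)) τ =
      ∫ τ in t..b, (-2) * (k τ * Real.exp (2 * ∫ σ in τ..b, k σ)) := by
    refine intervalIntegral.integral_congr_ae ?_
    filter_upwards [hk.ae_hasDerivAt_integral] with τ h1 hτ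
    have d := ((h1 (uIoc_subset_uIcc hτ) b right_mem_uIcc).const_mul (-2)).exp
    simp only [hrev] at d
    rw [d.deriv]; ring
  rw [h2, intervalIntegral.integral_const_mul] at key
  simp only [intervalIntegral.integral_same, mul_zero, Real.exp_zero] at key
  linarith

/-- Banach's fixed point theorem in a weighted sup norm. The weight `exp (2 ∫_t^1 k)`, with `k` an
integrable bound for the rates, gives a contraction on all of `[0,1]` at once, so no short intervals
have to be glued. -/
theorem exists_backward_solution {X : Type*} [Fintype X] (r : ℝ → X → X → ℝ)
    (hr : ∀ x y, IntegrableOn (fun t => r t y x) (Icc (0 : ℝ) 1)) (b : X → ℝ) :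
    ∃ h : ℝ → X → ℝ, (∀ y, Continuous fun t => h t y) ∧
      ∀ t ∈ Icc (0 : ℝ) 1, ∀ y, h t y = b y + ∫ τ in t..1, ∑ z, r τ z y * h τ z := by
  have hri : ∀ x y, IntervalIntegrable (fun t => r t y x) volume 0 1 := fun x y =>
    (intervalIntegrable_iff_integrableOn_Icc_of_le zero_le_one).2 (hr x y)
  set k : ℝ → ℝ := fun τ => ∑ y, ∑ z, |r τ z y|
  have hk : IntervalIntegrable k volume 0 1 := by
    have := IntervalIntegrable.sum (μ := volume) (a := 0) (b := 1) Finset.univ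
      (f := fun y τ => ∑ z, |r τ z y|) (fun y _ => by
        have := IntervalIntegrable.sum (μ := volume) (a := 0) (b := 1) Finset.univ
          (f := fun z τ => |r τ z y|) (fun z _ => (hri y z).abs)
        simpa [Finset.sum_fn] using this)
    simpa [Finset.sum_fn] using this
  let pr : ℝ → Icc (0 : ℝ) 1 := projIcc (0 : ℝ) 1 zero_le_one
  have hpr : Continuous pr := continuous_projIcc
  have hsub : ∀ t ∈ Icc (0 : ℝ) 1, uIcc t 1 ⊆ uIcc 0 1 := fun t ht =>
    uIcc_subset_uIcc (by rwa [uIcc_of_le zero_le_one]) right_mem_uIcc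
  have hcontI : ∀ f : ℝ → ℝ, IntervalIntegrable f volume 0 1 →
      Continuous fun t : Icc (0 : ℝ) 1 => ∫ τ in (t : ℝ)..1, f τ := by
    intro f hf
    have h1 := (hf.absolutelyContinuousOnInterval_intervalIntegral (c := 1)
      right_mem_uIcc).continuousOn
    rw [uIcc_of_le zero_le_one, continuousOn_iff_continuous_domRestrict] at h1
    refine h1.neg.congr fun t => ?_
    simp only [domRestrict_apply, Pi.neg_apply]
    rw [intervalIntegral.integral_symm (t : ℝ) 1]
    ring
  let W : Icc (0 : ℝ) 1 → ℝ := fun t => Real.exp (2 * ∫ τ in (t : ℝ)..1, k τ)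
  have hW : Continuous W := Real.continuous_exp.comp ((hcontI k hk).const_mul 2)
  have hW0 : ∀ t, 0 < W t := fun t => Real.exp_pos _
  have hint : ∀ (f : C(Icc (0 : ℝ) 1, X → ℝ)) (y : X),
      IntervalIntegrable (fun τ => ∑ z, r τ z y * (W (pr τ) * f (pr τ) z)) volume 0 1 := by
    intro f y
    have := IntervalIntegrable.sum (μ := volume) (a := 0) (b := 1) Finset.univ
      (f := fun z τ => r τ z y * (W (pr τ) * f (pr τ) z)) (fun z _ => by
        refine (hri y z).mul_continuousOn (Continuous.continuousOn ?_)
        exact (hW.comp hpr).mul ((continuous_apply z).comp (f.continuous.comp hpr)))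
    simpa [Finset.sum_fn] using this
  -- The backward integral operator conjugated by `W`: the unknown is `f = h / W`, so the plain sup
  -- norm of `f` is the weighted norm of `h`.
  let T : C(Icc (0 : ℝ) 1, X → ℝ) → C(Icc (0 : ℝ) 1, X → ℝ) := fun f =>
    ⟨fun t y => (W t)⁻¹ * (b y + ∫ τ in (t : ℝ)..1, ∑ z, r τ z y * (W (pr τ) * f (pr τ) z)),
      continuous_pi fun y => (hW.inv₀ fun t => (hW0 t).ne').mul
        (continuous_const.add (hcontI _ (hint f y)))⟩
  have hT : ContractingWith (1 / 2) T := by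
    refine ⟨by norm_num, LipschitzWith.of_dist_le_mul fun f g => ?_⟩
    rw [ContinuousMap.dist_le (by positivity)]
    intro t
    rw [dist_pi_le_iff (by positivity)]
    intro y
    have e1 : (T f t y - T g t y) = (W t)⁻¹ * ∫ τ in (t : ℝ)..1,
        ∑ z, r τ z y * (W (pr τ) * (f (pr τ) z - g (pr τ) z)) := by
      change (W t)⁻¹ * _ - (W t)⁻¹ * _ = _
      rw [← mul_sub, add_sub_add_left_eq_sub, ← intervalIntegral.integral_sub]
      · congr 2; ext τ; rw [← Finset.sum_sub_distrib]
        exact Finset.sum_congr rfl fun z _ => by ring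
      · exact (hint f y).mono_set (hsub t t.2)
      · exact (hint g y).mono_set (hsub t t.2)
    rw [Real.dist_eq, e1, abs_mul, abs_of_pos (inv_pos.2 (hW0 t)), inv_mul_le_iff₀ (hW0 t)]
    have hkt : IntervalIntegrable k volume t 1 := hk.mono_set (hsub t t.2)
    have e2 : |∫ τ in (t : ℝ)..1, ∑ z, r τ z y * (W (pr τ) * (f (pr τ) z - g (pr τ) z))| ≤
        ∫ τ in (t : ℝ)..1, (k τ * Real.exp (2 * ∫ σ in τ..1, k σ)) * dist f g := by
      rw [← Real.norm_eq_abs]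
      refine intervalIntegral.norm_integral_le_of_norm_le t.2.2 ?_ ?_
      · refine Eventually.of_forall fun τ hτ => ?_
        have hτ' : τ ∈ Icc (0 : ℝ) 1 := ⟨t.2.1.trans hτ.1.le, hτ.2⟩
        have hWτ : W (pr τ) = Real.exp (2 * ∫ σ in τ..1, k σ) := by
          simp only [W, pr, projIcc_of_mem zero_le_one hτ']
        rw [← hWτ]
        refine (norm_sum_le _ _).trans ?_
        have h3 : ∀ z, ‖r τ z y * (W (pr τ) * (f (pr τ) z - g (pr τ) z))‖ ≤
            |r τ z y| * (W (pr τ) * dist f g) := by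
          intro z
          rw [norm_mul, norm_mul, Real.norm_eq_abs, Real.norm_of_nonneg (hW0 _).le,
            ← dist_eq_norm]
          gcongr
          exact (dist_le_pi_dist _ _ z).trans (ContinuousMap.dist_apply_le_dist _)
        refine (Finset.sum_le_sum fun z _ => h3 z).trans ?_
        rw [← Finset.sum_mul, mul_assoc]
        refine mul_le_mul_of_nonneg_right ?_ (mul_nonneg (hW0 _).le dist_nonneg)
        exact Finset.single_le_sum (f := fun y => ∑ z, |r τ z y|)
          (fun y _ => Finset.sum_nonneg fun z _ => abs_nonneg _) (Finset.mem_univ y)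
      · refine IntervalIntegrable.mul_const ?_ _
        refine hkt.mul_continuousOn ?_
        have h1 := (hkt.absolutelyContinuousOnInterval_intervalIntegral (c := 1)
          right_mem_uIcc).continuousOn
        refine Real.continuous_exp.comp_continuousOn (ContinuousOn.const_mul ?_ 2)
        refine h1.neg.congr fun τ _ => ?_
        simp only [Pi.neg_apply]
        rw [intervalIntegral.integral_symm τ 1]
        ring
    refine e2.trans ?_
    rw [intervalIntegral.integral_mul_const, integral_mul_exp_primitive hkt]
    change (W t - 1) / 2 * dist f g ≤ W t * (((1 / 2 : NNReal) : ℝ) * dist f g)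
    push_cast
    nlinarith [dist_nonneg (x := f) (y := g)]
  set f := hT.fixedPoint T
  have hfix : T f = f := hT.fixedPoint_isFixedPt
  refine ⟨fun t y => W (pr t) * f (pr t) y, fun y =>
    (hW.comp hpr).mul ((continuous_apply y).comp (f.continuous.comp hpr)), fun t ht y => ?_⟩
  have h1 : f (pr t) y = T f (pr t) y := by rw [hfix]
  have h2 : ((pr t : Icc (0 : ℝ) 1) : ℝ) = t := by simp only [pr, projIcc_of_mem zero_le_one ht]
  change W (pr t) * f (pr t) y = _
  rw [h1]
  change W (pr t) * ((W (pr t))⁻¹ * (b y + ∫ τ in ((pr t : Icc (0 : ℝ) 1) : ℝ)..1,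
    ∑ z, r τ z y * (W (pr τ) * f (pr τ) z))) = _
  rw [mul_inv_cancel_left₀ (hW0 _).ne', h2]

end CTMC

namespace CTMC

open MeasureTheory Set Filter Topology

/-! ### Path space -/

section PathSpace

variable {X : Type*}

theorem past_mono {s t : ℝ} (hst : s ≤ t) : past X s ≤ past X t :=
  biSup_mono fun _ h => ⟨h.1, h.2.trans hst⟩

theorem past_le {s : ℝ} (hs : s ≤ 1) : past X s ≤ pathMeasurableSpace X :=
  past_mono hs

theorem measurableSet_past_at {s t : ℝ} (ht : 0 ≤ t) (hts : t ≤ s) (x : X) :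
    MeasurableSet[past X s] (at_ t x) := by
  have h : MeasurableSpace.comap (pos (X := X) t) ⊤ ≤ past X s :=
    le_biSup (fun t => MeasurableSpace.comap (pos (X := X) t) ⊤)
      (show t ∈ Icc (0 : ℝ) s from ⟨ht, hts⟩)
  exact h _ ⟨{x}, trivial, rfl⟩

theorem pos_eq_pos_proj (t : ℝ) :
    pos (X := X) t = pos ((projIcc (0 : ℝ) 1 zero_le_one t : Icc (0 : ℝ) 1) : ℝ) := by
  ext ω
  simp [pos]

theorem measurableSet_pos_preimage (t : ℝ) (S : Set X) :
    MeasurableSet {ω : PathSpace X | pos t ω ∈ S} := by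
  rw [pos_eq_pos_proj]
  have h : MeasurableSpace.comap
      (pos (X := X) ((projIcc (0 : ℝ) 1 zero_le_one t : Icc (0 : ℝ) 1) : ℝ)) ⊤ ≤
      pathMeasurableSpace X :=
    le_biSup (fun t => MeasurableSpace.comap (pos (X := X) t) ⊤)
      (projIcc (0 : ℝ) 1 zero_le_one t).2
  exact h _ ⟨S, trivial, rfl⟩

theorem measurableSet_at (t : ℝ) (x : X) : MeasurableSet (at_ t x) :=
  measurableSet_pos_preimage t {x}

theorem measurable_comp_pos {β : Type*} [MeasurableSpace β] (t : ℝ) (φ : X → β) :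
    Measurable fun ω : PathSpace X => φ (pos t ω) :=
  fun S _ => measurableSet_pos_preimage t (φ ⁻¹' S)

theorem at_inter_at_of_ne {t : ℝ} {x y : X} (h : x ≠ y) : at_ t x ∩ at_ t y = ∅ := by
  ext ω
  simp only [at_, mem_inter_iff, mem_ofPred_eq, mem_empty_iff_false, iff_false, not_and]
  rintro rfl
  exact h

/-- Clamping the time makes paths constant before 0 and after 1, so right-continuity extends to
every real time. -/
theorem tendsto_pos_right (ω : PathSpace X) (t : ℝ) :
    ∀ᶠ s in 𝓝[>] t, pos s ω = pos t ω := by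
  rcases lt_or_ge t 0 with h | h
  · filter_upwards [Ioo_mem_nhdsGT h] with s hs
    simp [pos, projIcc_of_le_left zero_le_one hs.2.le, projIcc_of_le_left zero_le_one h.le]
  rcases lt_or_ge t 1 with h1 | h1
  · have hω := ω.2.1 (projIcc (0 : ℝ) 1 zero_le_one t)
    have hlim : Tendsto (projIcc (0 : ℝ) 1 zero_le_one) (𝓝[>] t)
        (𝓝[>] (projIcc (0 : ℝ) 1 zero_le_one t)) := by
      refine tendsto_nhdsWithin_iff.2
        ⟨(continuous_projIcc.tendsto t).mono_left nhdsWithin_le_nhds, ?_⟩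
      filter_upwards [Ioo_mem_nhdsGT h1] with s hs
      rw [mem_Ioi, projIcc_of_mem zero_le_one ⟨h, h1.le⟩,
        projIcc_of_mem zero_le_one ⟨h.trans hs.1.le, hs.2.le⟩]
      exact hs.1
    exact hlim.eventually hω
  · filter_upwards [self_mem_nhdsWithin] with s hs
    simp [pos, projIcc_of_right_le zero_le_one h1,
      projIcc_of_right_le zero_le_one (h1.trans (le_of_lt hs))]

/-- Right-continuity of paths and dominated convergence make the function a pointwise limit of
functions of an integer part. This supplies the measurability in time behind all integrability
claims. -/
theorem measurable_real_inter_at (P : Measure (PathSpace X)) [IsFiniteMeasure P]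
    {B : Set (PathSpace X)} (hB : MeasurableSet B) (x : X) :
    Measurable fun t => P.real (B ∩ at_ t x) := by
  -- The first point of the grid of mesh `1 / (n + 1)` strictly to the right of `t`.
  let d : ℕ → ℝ → ℝ := fun n t => ((⌊(n + 1 : ℝ) * t⌋ : ℝ) + 1) / (n + 1)
  have hd : ∀ t, Tendsto (fun n => d n t) atTop (𝓝[>] t) := by
    intro t
    have hgt : ∀ n, t < d n t := by
      intro n
      have hn : (0 : ℝ) < n + 1 := by positivity
      rw [lt_div_iff₀ hn]
      linarith [Int.lt_floor_add_one ((n + 1 : ℝ) * t)]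
    have hle : ∀ n : ℕ, d n t ≤ t + 1 / ((n : ℝ) + 1) := by
      intro n
      have hn : (0 : ℝ) < n + 1 := by positivity
      have h1 : (t + 1 / ((n : ℝ) + 1)) * (n + 1) = (n + 1 : ℝ) * t + 1 := by field_simp
      rw [div_le_iff₀ hn, h1]
      linarith [Int.floor_le ((n + 1 : ℝ) * t)]
    refine tendsto_nhdsWithin_iff.2 ⟨?_, Eventually.of_forall hgt⟩
    refine tendsto_of_tendsto_of_tendsto_of_le_of_le tendsto_const_nhds ?_
      (fun n => (hgt n).le) hle
    simpa using tendsto_one_div_add_atTop_nhds_zero_nat.const_add t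
  refine measurable_of_tendsto_metrizable (f := fun n t => P.real (B ∩ at_ (d n t) x)) ?_ ?_
  · intro n
    have : (fun t => P.real (B ∩ at_ (d n t) x)) =
        (fun m : ℤ => P.real (B ∩ at_ (((m : ℝ) + 1) / (n + 1)) x)) ∘
          fun t : ℝ => ⌊(n + 1 : ℝ) * t⌋ := rfl
    rw [this]
    exact (measurable_from_top).comp (Int.measurable_floor.comp (measurable_id.const_mul _))
  · rw [tendsto_pi_nhds]
    intro t
    have hm : ∀ s, MeasurableSet (B ∩ at_ s x) := fun s => hB.inter (measurableSet_at s x)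
    simp only [← integral_indicator_one (hm _)]
    refine tendsto_integral_of_dominated_convergence (fun _ => 1)
      (fun n => (measurable_one.indicator (hm _)).aestronglyMeasurable) (integrable_const _)
      (fun n => Eventually.of_forall fun ω => ?_) (Eventually.of_forall fun ω => ?_)
    · refine (norm_indicator_le_norm_self _ _).trans ?_
      simp
    · refine tendsto_const_nhds.congr' ?_
      filter_upwards [(hd t).eventually (tendsto_pos_right ω t)] with n hn
      have h1 : ω ∈ B ∩ at_ t x ↔ ω ∈ B ∩ at_ (d n t) x := by
        change (_ ∧ pos t ω = x) ↔ (_ ∧ pos (d n t) ω = x)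
        rw [hn]
      by_cases hω : ω ∈ B ∩ at_ t x
      · simp [indicator_of_mem hω, indicator_of_mem (h1.1 hω)]
      · rw [indicator_of_notMem hω, indicator_of_notMem (mt h1.2 hω)]

variable [Fintype X]

theorem sum_real_inter_at (P : Measure (PathSpace X)) [IsFiniteMeasure P]
    (B : Set (PathSpace X)) (t : ℝ) : ∑ x, P.real (B ∩ at_ t x) = P.real B := by
  have h := sum_measureReal_preimage_singleton (μ := P.restrict B) Finset.univ (f := pos t)
    (fun y _ => measurableSet_at t y)
  simp only [Finset.coe_univ, preimage_univ, measureReal_restrict_apply_univ] at h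
  rw [← h]
  refine Finset.sum_congr rfl fun x _ => ?_
  change _ = (P.restrict B).real (at_ t x)
  rw [measureReal_restrict_apply (measurableSet_at t x), inter_comm]

theorem integral_comp_pos (P : Measure (PathSpace X)) [IsFiniteMeasure P] (t : ℝ) (φ : X → ℝ) :
    ∫ ω, φ (pos t ω) ∂P = ∑ x, φ x * P.real (at_ t x) := by
  have h : ∀ ω : PathSpace X, φ (pos t ω) = ∑ x, φ x * (at_ t x).indicator 1 ω := by
    intro ω
    rw [Finset.sum_eq_single (pos t ω)] <;> simp +contextual [at_, indicator, eq_comm]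
  simp only [h]
  rw [integral_finsetSum]
  · simp only [integral_const_mul, integral_indicator_one (measurableSet_at t _)]
  · exact fun x _ => ((integrable_const (1 : ℝ)).indicator (measurableSet_at t x)).const_mul _

theorem real_withDensity_pos (P : Measure (PathSpace X)) [IsFiniteMeasure P] (t : ℝ) (φ : X → ℝ)
    (hφ : ∀ x, 0 ≤ φ x) {B : Set (PathSpace X)} (hB : MeasurableSet B) :
    (P.withDensity fun ω => ENNReal.ofReal (φ (pos t ω))).real B =
      ∑ x, φ x * P.real (B ∩ at_ t x) := by
  rw [measureReal_def, withDensity_apply _ hB, ← integral_eq_lintegral_of_nonneg_ae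
    (Eventually.of_forall fun ω => hφ _) (measurable_comp_pos t φ).aestronglyMeasurable,
    integral_comp_pos]
  refine Finset.sum_congr rfl fun x _ => ?_
  rw [measureReal_restrict_apply (measurableSet_at t x), inter_comm]

theorem isFiniteMeasure_withDensity_pos (P : Measure (PathSpace X)) [IsFiniteMeasure P] (t : ℝ)
    (φ : X → ℝ) : IsFiniteMeasure (P.withDensity fun ω => ENNReal.ofReal (φ (pos t ω))) := by
  refine isFiniteMeasure_withDensity_ofReal (HasFiniteIntegral.of_bounded
    (C := ∑ x, |φ x|) (Eventually.of_forall fun ω => ?_))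
  exact Finset.single_le_sum (f := fun x => |φ x|) (fun x _ => abs_nonneg _)
    (Finset.mem_univ (pos t ω))

end PathSpace

end CTMC

namespace CTMC

open MeasureTheory Set Filter Topology

/-! ### Forward equations against backward equations -/

section Forward

variable {X : Type*}

theorem integrableOn_rate_mul_real {r : ℝ → X → X → ℝ}
    (hr : ∀ x y, IntegrableOn (fun t => r t y x) (Icc (0 : ℝ) 1))
    (P : Measure (PathSpace X)) [IsFiniteMeasure P] {B : Set (PathSpace X)}
    (hB : MeasurableSet B) (x y : X) :
    IntegrableOn (fun t => r t y x * P.real (B ∩ at_ t x)) (Icc (0 : ℝ) 1) := by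
  refine (hr x y).mul_bdd (c := P.real univ)
    (measurable_real_inter_at P hB x).aestronglyMeasurable (Eventually.of_forall fun t => ?_)
  rw [Real.norm_of_nonneg measureReal_nonneg]
  exact measureReal_mono (subset_univ _)

variable [Fintype X]

theorem intervalIntegrable_finset_sum {f : X → ℝ → ℝ} {a b : ℝ}
    (hf : ∀ x, IntervalIntegrable (f x) volume a b) :
    IntervalIntegrable (fun t => ∑ x, f x t) volume a b := by
  simpa [Finset.sum_fn] using IntervalIntegrable.sum Finset.univ fun x _ => hf x

theorem intervalIntegrable_sum_rate_mul_real {r : ℝ → X → X → ℝ}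
    (hr : ∀ x y, IntegrableOn (fun t => r t y x) (Icc (0 : ℝ) 1))
    (P : Measure (PathSpace X)) [IsFiniteMeasure P] {B : Set (PathSpace X)}
    (hB : MeasurableSet B) (y : X) {s t : ℝ} (hs : 0 ≤ s) (hst : s ≤ t) (ht : t ≤ 1) :
    IntervalIntegrable (fun τ => ∑ z, r τ y z * P.real (B ∩ at_ τ z)) volume s t :=
  intervalIntegrable_finset_sum fun z =>
    (intervalIntegrable_iff_integrableOn_Icc_of_le hst).2
      ((integrableOn_rate_mul_real hr P hB z y).mono_set (Icc_subset_Icc hs ht))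

/-- `h` solves the backward equation with rates `r` and terminal value `ψ` at time `1`. -/
def SolvesBackward (r : ℝ → X → X → ℝ) (ψ : X → ℝ) (h : ℝ → X → ℝ) : Prop :=
  (∀ y, Continuous fun t => h t y) ∧
    ∀ t ∈ Icc (0 : ℝ) 1, ∀ y, h t y = ψ y + ∫ τ in t..1, ∑ z, r τ z y * h τ z

variable {mu : X → ℝ} {r : ℝ → X → X → ℝ} {P : Measure (PathSpace X)} {ψ : X → ℝ}
  {h : ℝ → X → ℝ}

theorem SolvesBackward.intervalIntegrable (hh : SolvesBackward r ψ h)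
    (hr : ∀ x y, IntegrableOn (fun t => r t y x) (Icc (0 : ℝ) 1)) (y : X) {s t : ℝ}
    (hs : 0 ≤ s) (hst : s ≤ t) (ht : t ≤ 1) :
    IntervalIntegrable (fun τ => ∑ z, r τ z y * h τ z) volume s t :=
  intervalIntegrable_finset_sum fun z => IntervalIntegrable.mul_continuousOn
    ((intervalIntegrable_iff_integrableOn_Icc_of_le hst).2
      ((hr y z).mono_set (Icc_subset_Icc hs ht))) (hh.1 z).continuousOn

theorem SolvesBackward.eq_add_integral (hh : SolvesBackward r ψ h)
    (hr : ∀ x y, IntegrableOn (fun t => r t y x) (Icc (0 : ℝ) 1)) (y : X) {s t : ℝ}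
    (hs : 0 ≤ s) (hst : s ≤ t) (ht : t ≤ 1) :
    h t y = h s y + ∫ τ in s..t, -∑ z, r τ z y * h τ z := by
  rw [hh.2 s ⟨hs, hst.trans ht⟩ y, hh.2 t ⟨hs.trans hst, ht⟩ y, intervalIntegral.integral_neg,
    ← intervalIntegral.integral_add_adjacent_intervals
      (hh.intervalIntegrable hr y hs hst ht)
      (hh.intervalIntegrable hr y (hs.trans hst) ht le_rfl)]
  ring

theorem SolvesBackward.terminal (hh : SolvesBackward r ψ h) (y : X) : h 1 y = ψ y := by
  rw [hh.2 1 (right_mem_Icc.2 zero_le_one), intervalIntegral.integral_same, add_zero]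

/-- Product rule for the forward equation against the backward one. Summed over `y` it gives
Feynman-Kac; for a single `y` it becomes the forward equation of Doob's transform. -/
theorem real_mul_backward_sub (hP : IsCTMC mu r P) (hh : SolvesBackward r ψ h)
    (hr : ∀ x y, IntegrableOn (fun t => r t y x) (Icc (0 : ℝ) 1)) (x y : X) {s t : ℝ}
    (hs : 0 ≤ s) (hst : s ≤ t) (ht : t ≤ 1) :
    P.real (at_ s x ∩ at_ t y) * h t y - P.real (at_ s x ∩ at_ s y) * h s y =
      ∫ τ in s..t, ((∑ z, r τ y z * P.real (at_ s x ∩ at_ τ z)) * h τ y +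
        P.real (at_ s x ∩ at_ τ y) * -∑ z, r τ z y * h τ z) := by
  have := hP.isProbabilityMeasure
  exact mul_sub_mul_eq_integral (F := fun t => P.real (at_ s x ∩ at_ t y))
    (G := fun t => h t y) hst
    (intervalIntegrable_sum_rate_mul_real hr P (measurableSet_at s x) y hs hst ht)
    (hh.intervalIntegrable hr y hs hst ht).neg
    (fun t' h' => hP.forward s t' hs h'.1 (h'.2.trans ht) x y)
    (fun t' h' => hh.eq_add_integral hr y hs h'.1 (h'.2.trans ht))

theorem intervalIntegrable_real_mul_backward (hP : IsCTMC mu r P) (hh : SolvesBackward r ψ h)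
    (hr : ∀ x y, IntegrableOn (fun t => r t y x) (Icc (0 : ℝ) 1)) (x y : X) {s t : ℝ}
    (hs : 0 ≤ s) (hst : s ≤ t) (ht : t ≤ 1) :
    IntervalIntegrable (fun τ => (∑ z, r τ y z * P.real (at_ s x ∩ at_ τ z)) * h τ y +
        P.real (at_ s x ∩ at_ τ y) * -∑ z, r τ z y * h τ z) volume s t := by
  have := hP.isProbabilityMeasure
  refine ((intervalIntegrable_sum_rate_mul_real hr P (measurableSet_at s x) y hs hst
    ht).mul_continuousOn (hh.1 y).continuousOn).add ?_
  rw [intervalIntegrable_iff]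
  refine (intervalIntegrable_iff.1 (hh.intervalIntegrable hr y hs hst ht).neg).bdd_mul (c := 1)
    (measurable_real_inter_at P (measurableSet_at s x) y).aestronglyMeasurable
    (Eventually.of_forall fun t => ?_)
  rw [Real.norm_of_nonneg measureReal_nonneg]
  exact measureReal_le_one

theorem sum_real_inter_at_self_mul (P : Measure (PathSpace X)) (s : ℝ) (x : X) (f : X → ℝ) :
    ∑ y, P.real (at_ s x ∩ at_ s y) * f y = P.real (at_ s x) * f x := by
  rw [Finset.sum_eq_single x, inter_self]
  · intro y _ hy
    rw [at_inter_at_of_ne hy.symm, measureReal_empty, zero_mul]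
  · simp

/-- Feynman-Kac: the solution of the backward equation is the conditional expectation of the
terminal value. -/
theorem sum_real_inter_mul_terminal (hP : IsCTMC mu r P) (hh : SolvesBackward r ψ h)
    (hr : ∀ x y, IntegrableOn (fun t => r t y x) (Icc (0 : ℝ) 1)) (x : X) {s : ℝ}
    (hs : 0 ≤ s) (hs1 : s ≤ 1) :
    ∑ y, P.real (at_ s x ∩ at_ 1 y) * ψ y = P.real (at_ s x) * h s x := by
  have key : ∑ y, (P.real (at_ s x ∩ at_ 1 y) * h 1 y - P.real (at_ s x ∩ at_ s y) * h s y)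
      = 0 := by
    simp only [real_mul_backward_sub hP hh hr x _ hs hs1 le_rfl]
    rw [← intervalIntegral.integral_finsetSum fun y _ =>
      intervalIntegrable_real_mul_backward hP hh hr x y hs hs1 le_rfl]
    -- The forward operator is the transpose of the backward one, so the two double sums cancel
    -- after exchanging indices.
    have h0 : ∀ τ, ∑ y, ((∑ z, r τ y z * P.real (at_ s x ∩ at_ τ z)) * h τ y +
        P.real (at_ s x ∩ at_ τ y) * -∑ z, r τ z y * h τ z) = 0 := by
      intro τ
      simp only [mul_neg, ← sub_eq_add_neg, Finset.sum_sub_distrib, Finset.sum_mul,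
        Finset.mul_sum]
      rw [Finset.sum_comm, sub_eq_zero]
      exact Finset.sum_congr rfl fun y _ => Finset.sum_congr rfl fun z _ => by ring
    simp only [h0, intervalIntegral.integral_zero]
  rw [Finset.sum_sub_distrib, sum_real_inter_at_self_mul, sub_eq_zero] at key
  simpa only [hh.terminal] using key

/-- By Feynman-Kac, `h s x` is an average of the positive values of `ψ`; this makes sense only where
the state has positive probability. -/
theorem backward_pos (hP : IsCTMC mu r P) (hh : SolvesBackward r ψ h)
    (hr : ∀ x y, IntegrableOn (fun t => r t y x) (Icc (0 : ℝ) 1)) (hψ : ∀ x, 0 < ψ x) (x : X)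
    {s : ℝ} (hs : 0 ≤ s) (hs1 : s ≤ 1) (hx : P.real (at_ s x) ≠ 0) : 0 < h s x := by
  have := hP.isProbabilityMeasure
  have hx' : 0 < P.real (at_ s x) := lt_of_le_of_ne measureReal_nonneg hx.symm
  refine pos_of_mul_pos_right (a := P.real (at_ s x)) ?_ hx'.le
  rw [← sum_real_inter_mul_terminal hP hh hr x hs hs1]
  have hsum := sum_real_inter_at P (at_ s x) 1
  obtain ⟨y, -, hy⟩ := Finset.exists_ne_zero_of_sum_ne_zero (hsum.trans_ne hx)
  exact Finset.sum_pos' (fun y _ => mul_nonneg measureReal_nonneg (hψ y).le)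
    ⟨y, Finset.mem_univ y, mul_pos (lt_of_le_of_ne measureReal_nonneg hy.symm) (hψ y)⟩

theorem real_at_eq_add_integral (hP : IsCTMC mu r P)
    (hr : ∀ x y, IntegrableOn (fun t => r t y x) (Icc (0 : ℝ) 1)) (y : X) {t : ℝ}
    (ht0 : 0 ≤ t) (ht : t ≤ 1) :
    P.real (at_ t y) = P.real (at_ 0 y) + ∫ τ in (0 : ℝ)..t, ∑ z, r τ y z * P.real (at_ τ z) := by
  have := hP.isProbabilityMeasure
  have hmarg : ∀ τ z, ∑ x, P.real (at_ 0 x ∩ at_ τ z) = P.real (at_ τ z) := fun τ z => by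
    simpa only [inter_comm] using sum_real_inter_at P (at_ τ z) 0
  rw [← hmarg t, ← hmarg 0, Finset.sum_congr rfl fun x _ => hP.forward 0 t le_rfl ht0 ht x y,
    Finset.sum_add_distrib, ← intervalIntegral.integral_finsetSum fun x _ =>
      intervalIntegrable_sum_rate_mul_real hr P (measurableSet_at 0 x) y le_rfl ht0 ht]
  congr 2
  ext τ
  rw [Finset.sum_comm]
  exact Finset.sum_congr rfl fun z _ => by rw [← Finset.mul_sum, hmarg]

/-- There is no flux into states of probability zero. -/
theorem ae_rate_mul_real_eq_zero (hP : IsCTMC mu r P)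
    (hr : ∀ x y, IntegrableOn (fun t => r t y x) (Icc (0 : ℝ) 1)) (y : X) :
    ∀ᵐ t, t ∈ Icc (0 : ℝ) 1 → P.real (at_ t y) = 0 →
      ∀ z, z ≠ y → r t y z * P.real (at_ t z) = 0 := by
  have := hP.isProbabilityMeasure
  have hint : IntervalIntegrable (fun τ => ∑ z, r τ y z * P.real (at_ τ z)) volume 0 1 := by
    simpa only [univ_inter] using intervalIntegrable_sum_rate_mul_real hr P MeasurableSet.univ y
      le_rfl zero_le_one le_rfl
  -- The occupation probability has zero derivative where it vanishes. There the derivative is a sum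
  -- of nonnegative inflows, the diagonal term being killed by the vanishing probability, so each
  -- inflow is zero.
  filter_upwards [ae_eq_zero_of_primitive_eq_zero (F := fun t => P.real (at_ t y)) zero_le_one
    hint (fun t ht => real_at_eq_add_integral hP hr y ht.1 ht.2)
    (fun t _ => measureReal_nonneg)] with t h1 ht h0 z hz
  refine (Finset.sum_eq_zero_iff_of_nonneg fun z _ => ?_).1 (h1 ht h0) z (Finset.mem_univ z)
  by_cases hzy : z = y
  · rw [hzy, h0, mul_zero]
  · exact mul_nonneg (hP.rate_nonneg t ht z y (Ne.symm hzy)) measureReal_nonneg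

end Forward

/-! ### Doob's transform -/

section Doob

variable {X : Type*}

/-- Off-diagonal rates of Doob's transform of the rates `r` by the function `h`. -/
noncomputable def doobJump (r : X → X → ℝ) (h : X → ℝ) (y x : X) : ℝ := r y x * (max (h y) 0 / max (h x) 0)

/-- The positive parts keep the rates nonnegative even where the sign of `h` is unknown. At states
charged by `m` the denominator is `h z` itself and cancels. -/
theorem doobJump_mul {r : X → X → ℝ} {h m : X → ℝ} (hm : ∀ z, m z ≠ 0 → 0 < h z) (y z : X) :
    doobJump r h y z * (m z * h z) = r y z * m z * max (h y) 0 := by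
  by_cases hz : m z = 0
  · simp [hz]
  · have h0 := hm z hz
    rw [doobJump, max_eq_left h0.le]
    field_simp

theorem real_withDensity_eq_zero {P : Measure (PathSpace X)} [IsFiniteMeasure P] {φ : X → ℝ}
    {B : Set (PathSpace X)}
    (hB : P.real B = 0) :
    (P.withDensity fun ω => ENNReal.ofReal (φ (pos 0 ω))).real B = 0 := by
  rw [measureReal_eq_zero_iff] at hB
  rw [measureReal_def, withDensity_absolutelyContinuous P _ hB, ENNReal.toReal_zero]

variable [Fintype X]

open Classical in
/-- Doob's transform of the rates `r` by the function `h`. -/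
noncomputable def doobRate (r : X → X → ℝ) (h : X → ℝ) (y x : X) : ℝ :=
  if y = x then -∑ z ∈ Finset.univ.erase x, doobJump r h z x else doobJump r h y x

theorem doobRate_of_ne (r : X → X → ℝ) (h : X → ℝ) {y x : X} (hyx : y ≠ x) :
    doobRate r h y x = doobJump r h y x := if_neg hyx

theorem sum_doobRate (r : X → X → ℝ) (h : X → ℝ) (x : X) : ∑ y, doobRate r h y x = 0 := by
  classical
  rw [← Finset.add_sum_erase _ _ (Finset.mem_univ x), Finset.sum_congr rfl fun y hy =>
    doobRate_of_ne r h (Finset.ne_of_mem_erase hy), doobRate, if_pos rfl]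
  convert neg_add_cancel _

/-- The right side is the product-rule integrand for `m * h`. Its two terms in `r y y` cancel; what
remains is the inflow and the outflow under the transformed rates. `hflux` covers targets where the
positive part might differ from `h y`: no mass jumps there. -/
theorem sum_doobRate_mul {r : X → X → ℝ} {h m : X → ℝ} (hm : ∀ z, m z ≠ 0 → 0 < h z)
    (hflux : ∀ y z, z ≠ y → 0 < h y ∨ r y z * m z = 0) (y : X) :
    ∑ z, doobRate r h y z * (m z * h z) =
      (∑ z, r y z * m z) * h y + m y * -∑ z, r z y * h z := by
  classical
  have hjump : ∀ y z, z ≠ y → doobJump r h y z * (m z * h z) = r y z * m z * h y := by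
    intro y z hzy
    rw [doobJump_mul hm]
    rcases hflux y z hzy with h0 | h0
    · rw [max_eq_left h0.le]
    · rw [h0, zero_mul, zero_mul]
  have hdiag : doobRate r h y y = -∑ z ∈ Finset.univ.erase y, doobJump r h z y := by
    rw [doobRate, if_pos rfl]
  rw [← Finset.add_sum_erase _ _ (Finset.mem_univ y), hdiag,
    ← Finset.add_sum_erase _ (fun z => r y z * m z) (Finset.mem_univ y),
    ← Finset.add_sum_erase _ (fun z => r z y * h z) (Finset.mem_univ y), neg_mul,
    Finset.sum_mul, Finset.sum_congr rfl fun z hz => hjump z y (Finset.ne_of_mem_erase hz).symm,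
    Finset.sum_congr rfl fun z hz => show doobRate r h y z * (m z * h z) = r y z * m z * h y by
      rw [doobRate_of_ne r h (Finset.ne_of_mem_erase hz).symm,
        hjump y z (Finset.ne_of_mem_erase hz)]]
  have e : ∑ z ∈ Finset.univ.erase y, r z y * m y * h z =
      m y * ∑ z ∈ Finset.univ.erase y, r z y * h z := by
    rw [Finset.mul_sum]
    exact Finset.sum_congr rfl fun z _ => by ring
  rw [e, ← Finset.sum_mul]
  ring

/-- The path measure with density `φ (X_0) ψ (X_1)`. -/
noncomputable def endpointReweight (P : Measure (PathSpace X)) (φ ψ : X → ℝ) : Measure (PathSpace X) :=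
  (P.withDensity fun ω => ENNReal.ofReal (φ (pos 0 ω))).withDensity
    fun ω => ENNReal.ofReal (ψ (pos 1 ω))

variable {mu : X → ℝ} {r : ℝ → X → X → ℝ} {P : Measure (PathSpace X)} {φ ψ : X → ℝ}
  {h : ℝ → X → ℝ}

/-- Feynman-Kac given the whole past: the Markov property removes `A`. Cancelling `P.real (at_ t y)`
forces the separate null case. -/
theorem real_inter_mul_backward (hP : IsCTMC mu r P) (hh : SolvesBackward r ψ h)
    (hr : ∀ x y, IntegrableOn (fun t => r t y x) (Icc (0 : ℝ) 1)) {t : ℝ} (ht0 : 0 ≤ t)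
    (ht : t ≤ 1) {A : Set (PathSpace X)} (hA : MeasurableSet[past X t] A) (y : X) :
    ∑ w, ψ w * P.real (A ∩ at_ t y ∩ at_ 1 w) = P.real (A ∩ at_ t y) * h t y := by
  have := hP.isProbabilityMeasure
  by_cases h0 : P.real (at_ t y) = 0
  · have h1 : ∀ B ⊆ at_ t y, P.real B = 0 := fun B hB =>
      le_antisymm (h0 ▸ measureReal_mono hB) measureReal_nonneg
    rw [h1 _ inter_subset_right, zero_mul]
    exact Finset.sum_eq_zero fun w _ => by
      rw [h1 _ (inter_subset_left.trans inter_subset_right), mul_zero]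
  · refine mul_right_cancel₀ h0 ?_
    rw [mul_assoc, mul_comm (h t y), ← sum_real_inter_mul_terminal hP hh hr y ht0 ht,
      Finset.sum_mul, Finset.mul_sum]
    refine Finset.sum_congr rfl fun w _ => ?_
    rw [mul_assoc, hP.markov t 1 ht0 ht le_rfl A hA y w]
    ring

/-- Conditioning the density on the past of `t` replaces `ψ (X_1)` by `h t X_t`, while `φ (X_0)` is
already determined by that past. -/
theorem real_endpointReweight_inter (hP : IsCTMC mu r P) (hh : SolvesBackward r ψ h)
    (hr : ∀ x y, IntegrableOn (fun t => r t y x) (Icc (0 : ℝ) 1)) (hφ : ∀ x, 0 ≤ φ x)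
    (hψ : ∀ x, 0 < ψ x) {t : ℝ} (ht0 : 0 ≤ t) (ht : t ≤ 1) {A : Set (PathSpace X)}
    (hA : MeasurableSet[past X t] A) (y : X) :
    (endpointReweight P φ ψ).real (A ∩ at_ t y) =
      (P.withDensity fun ω => ENNReal.ofReal (φ (pos 0 ω))).real (A ∩ at_ t y) * h t y := by
  have := hP.isProbabilityMeasure
  have := isFiniteMeasure_withDensity_pos P 0 φ
  have hA' : MeasurableSet (A ∩ at_ t y) := (past_le ht _ hA).inter (measurableSet_at t y)
  rw [endpointReweight, real_withDensity_pos _ _ _ (fun x => (hψ x).le) hA',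
    real_withDensity_pos _ _ _ hφ hA', Finset.sum_mul]
  have h1 : ∀ z, φ z * P.real (A ∩ at_ t y ∩ at_ 0 z) * h t y =
      ∑ w, φ z * (ψ w * P.real (A ∩ at_ t y ∩ at_ 1 w ∩ at_ 0 z)) := by
    intro z
    -- The event `X_0 = z` belongs to the past, so it can be absorbed into `A`.
    have hz := real_inter_mul_backward hP hh hr ht0 ht
      (hA.inter (measurableSet_past_at le_rfl ht0 z)) y
    rw [← Finset.mul_sum, mul_assoc, inter_right_comm, ← hz]
    congr 1
    refine Finset.sum_congr rfl fun w _ => ?_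
    congr 2
    ext ω; simp only [mem_inter_iff]; tauto
  simp only [h1]
  rw [Finset.sum_comm]
  refine Finset.sum_congr rfl fun w _ => ?_
  rw [real_withDensity_pos _ _ _ hφ (hA'.inter (measurableSet_at 1 w)), Finset.mul_sum]
  exact Finset.sum_congr rfl fun z _ => by ring

/-- A weight on `X_0` depends only on the past, hence leaves the transition probabilities of `P`
unchanged. -/
theorem real_withDensity_markov (hP : IsCTMC mu r P) (hφ : ∀ x, 0 ≤ φ x) {s t : ℝ} (hs : 0 ≤ s)
    (hst : s ≤ t) (ht : t ≤ 1) {A : Set (PathSpace X)} (hA : MeasurableSet[past X s] A)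
    (x y : X) :
    (P.withDensity fun ω => ENNReal.ofReal (φ (pos 0 ω))).real (A ∩ at_ s x ∩ at_ t y) *
        P.real (at_ s x) =
      (P.withDensity fun ω => ENNReal.ofReal (φ (pos 0 ω))).real (A ∩ at_ s x) *
        P.real (at_ s x ∩ at_ t y) := by
  have := hP.isProbabilityMeasure
  have hA' : MeasurableSet (A ∩ at_ s x) :=
    (past_le (hst.trans ht) _ hA).inter (measurableSet_at s x)
  rw [real_withDensity_pos _ _ _ hφ hA',
    real_withDensity_pos _ _ _ hφ (hA'.inter (measurableSet_at t y)), Finset.sum_mul,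
    Finset.sum_mul]
  refine Finset.sum_congr rfl fun z _ => ?_
  have h1 := hP.markov s t hs hst ht _ (hA.inter (measurableSet_past_at le_rfl hs z)) x y
  rw [inter_right_comm _ (at_ t y), inter_right_comm A (at_ s x), mul_assoc, h1, mul_assoc]

/-- The event `A` enters only through a factor free of `t` and `y`. Both the Markov property and the
forward equation of the reweighted measure rest on this separation. At null `x` both sides are zero,
with `0 / 0 = 0`. -/
theorem real_endpointReweight_inter_inter (hP : IsCTMC mu r P) (hh : SolvesBackward r ψ h)
    (hr : ∀ x y, IntegrableOn (fun t => r t y x) (Icc (0 : ℝ) 1)) (hφ : ∀ x, 0 ≤ φ x)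
    (hψ : ∀ x, 0 < ψ x) {s t : ℝ} (hs : 0 ≤ s) (hst : s ≤ t) (ht : t ≤ 1)
    {A : Set (PathSpace X)} (hA : MeasurableSet[past X s] A) (x y : X) :
    (endpointReweight P φ ψ).real (A ∩ at_ s x ∩ at_ t y) =
      (P.withDensity fun ω => ENNReal.ofReal (φ (pos 0 ω))).real (A ∩ at_ s x) /
        P.real (at_ s x) * (P.real (at_ s x ∩ at_ t y) * h t y) := by
  have := hP.isProbabilityMeasure
  have hA' : MeasurableSet[past X t] (A ∩ at_ s x) :=
    (past_mono hst _ hA).inter (measurableSet_past_at hs hst x)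
  rw [real_endpointReweight_inter hP hh hr hφ hψ (hs.trans hst) ht hA']
  by_cases h0 : P.real (at_ s x) = 0
  · rw [real_withDensity_eq_zero, h0, div_zero, zero_mul, zero_mul]
    exact le_antisymm (h0 ▸ measureReal_mono (inter_subset_left.trans inter_subset_right))
      measureReal_nonneg
  · rw [← mul_assoc, div_mul_eq_mul_div, ← real_withDensity_markov hP hφ hs hst ht hA,
      mul_div_cancel_right₀ _ h0]

/-- Reweighting the endpoints of a continuous-time Markov chain gives a continuous-time Markov
chain, whose rates are given by Doob's transform. -/
theorem exists_isCTMC_endpointReweight (hP : IsCTMC mu r P) (hmu : ∑ x, mu x = 1)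
    (hr : ∀ x y, IntegrableOn (fun t => r t y x) (Icc (0 : ℝ) 1)) (hφ : ∀ x, 0 ≤ φ x)
    (hψ : ∀ x, 0 < ψ x) (hinit : ∀ x, (endpointReweight P φ ψ).real (at_ 0 x) = mu x) :
    ∃ u, IsCTMC mu u (endpointReweight P φ ψ) := by
  obtain ⟨h, hh⟩ : ∃ h, SolvesBackward r ψ h := exists_backward_solution r hr ψ
  have hPp := hP.isProbabilityMeasure
  have hP0 := isFiniteMeasure_withDensity_pos P 0 φ
  have hQ : IsFiniteMeasure (endpointReweight P φ ψ) :=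
    isFiniteMeasure_withDensity_pos _ 1 ψ
  have hat : ∀ s, 0 ≤ s → s ≤ 1 → ∀ x, (endpointReweight P φ ψ).real (at_ s x) =
      (P.withDensity fun ω => ENNReal.ofReal (φ (pos 0 ω))).real (at_ s x) * h s x := by
    intro s hs hs1 x
    simpa only [univ_inter] using
      real_endpointReweight_inter hP hh hr hφ hψ hs hs1 MeasurableSet.univ x
  have hjoint : ∀ s t, 0 ≤ s → s ≤ t → t ≤ 1 → ∀ x y,
      (endpointReweight P φ ψ).real (at_ s x ∩ at_ t y) =
      (P.withDensity fun ω => ENNReal.ofReal (φ (pos 0 ω))).real (at_ s x) /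
        P.real (at_ s x) * (P.real (at_ s x ∩ at_ t y) * h t y) := by
    intro s t hs hst ht x y
    simpa only [univ_inter] using
      real_endpointReweight_inter_inter hP hh hr hφ hψ hs hst ht MeasurableSet.univ x y
  refine ⟨fun t => doobRate (r t) (h t), ⟨?_, ?_, ?_, hinit, ?_, ?_, ?_⟩⟩
  · intro t ht x y hyx
    rw [doobRate_of_ne _ _ hyx, doobJump]
    have := hP.rate_nonneg t ht x y hyx
    positivity
  · exact fun t _ x => sum_doobRate _ _ x
  · constructor
    have h1 := sum_real_inter_at (endpointReweight P φ ψ) univ 0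
    simp only [univ_inter, hinit, hmu] at h1
    rwa [eq_comm, measureReal_def, ENNReal.toReal_eq_one_iff] at h1
  · intro s t hs hst ht A hA x y
    rw [real_endpointReweight_inter_inter hP hh hr hφ hψ hs hst ht hA, hat s hs (hst.trans ht),
      hjoint s t hs hst ht,
      real_endpointReweight_inter hP hh hr hφ hψ hs (hst.trans ht) hA]
    ring
  · have hoff : ∀ x y, IntegrableOn (fun t => doobJump (r t) (h t) y x *
        (endpointReweight P φ ψ).real (at_ t x)) (Icc (0 : ℝ) 1) := by
      intro x y
      have h1 := integrableOn_rate_mul_real hr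
        (P.withDensity fun ω => ENNReal.ofReal (φ (pos 0 ω))) MeasurableSet.univ x y
      simp only [univ_inter] at h1
      -- The factor `h t x` of the reweighted marginal cancels the denominator of the rate, leaving
      -- an integrable function times a continuous one.
      refine (h1.mul_continuousOn (g' := fun t => max (h t y) 0)
        ((hh.1 y).max continuous_const).continuousOn isCompact_Icc).congr_fun
        (fun t ht => ?_) measurableSet_Icc
      simp only [hat t ht.1 ht.2]
      refine (doobJump_mul (m := fun x =>
        (P.withDensity fun ω => ENNReal.ofReal (φ (pos 0 ω))).real (at_ t x))
        (fun z hz => backward_pos hP hh hr hψ z ht.1 ht.2 fun h0 => hz ?_) y x).symm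
      exact real_withDensity_eq_zero h0
    intro x y
    by_cases hyx : y = x
    · subst hyx
      simp only [doobRate, if_true, neg_mul, Finset.sum_mul]
      exact (integrable_finsetSum _ fun z _ => hoff y z).neg
    · simp only [doobRate_of_ne _ _ hyx]
      exact hoff x y
  · intro s t hs hst ht x y
    -- This factor does not depend on the later time, so the forward equation is `c` times the
    -- product rule for `real_mul_backward_sub`.
    set c := (P.withDensity fun ω => ENNReal.ofReal (φ (pos 0 ω))).real (at_ s x) /
        P.real (at_ s x) with hc
    rw [hjoint s t hs hst ht, hjoint s s hs le_rfl (hst.trans ht), ← hc, ← sub_eq_iff_eq_add',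
      ← mul_sub, real_mul_backward_sub hP hh hr x y hs hst ht,
      ← intervalIntegral.integral_const_mul]
    refine intervalIntegral.integral_congr_ae ?_
    filter_upwards [(eventually_all.2 fun y => ae_rate_mul_real_eq_zero hP hr y :
      ∀ᵐ t, ∀ y, t ∈ Icc (0 : ℝ) 1 → P.real (at_ t y) = 0 →
      ∀ z, z ≠ y → r t y z * P.real (at_ t z) = 0)] with τ hτ hτI
    rw [uIoc_of_le hst] at hτI
    have hτ0 : 0 ≤ τ := hs.trans hτI.1.le
    have hτ1 : τ ≤ 1 := hτI.2.trans ht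
    have hle : ∀ z, P.real (at_ τ z) = 0 → P.real (at_ s x ∩ at_ τ z) = 0 := fun z hz =>
      le_antisymm (hz ▸ measureReal_mono inter_subset_right) measureReal_nonneg
    rw [← sum_doobRate_mul (r := r τ) (h := h τ) (m := fun z => P.real (at_ s x ∩ at_ τ z))
      (fun z hz => backward_pos hP hh hr hψ z hτ0 hτ1 (mt (hle z) hz)) ?_ y, Finset.mul_sum]
    · refine Finset.sum_congr rfl fun z _ => ?_
      rw [hjoint s τ hs hτI.1.le hτ1]
      ring
    · intro y z hzy
      by_cases h0 : P.real (at_ τ y) = 0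
      · right
        rcases mul_eq_zero.1 (hτ y ⟨hτ0, hτ1⟩ h0 z hzy) with h1 | h1
        · rw [h1, zero_mul]
        · rw [hle z h1, mul_zero]
      · exact Or.inl (backward_pos hP hh hr hψ y hτ0 hτ1 h0)

end Doob

end CTMC

namespace CTMC

open MeasureTheory ProbabilityTheory Set Filter Topology InformationTheory

/-! ### Relative entropy with respect to a tilted measure -/

/-- With normalization 1, the log-likelihood ratios against `Q` and against the tilted measure
differ by `f`. The two measures are mutually absolutely continuous and `f` is `P`-integrable, so
both divergences are infinite together. -/
theorem klDiv_eq_klDiv_tilted_add {Ω : Type*} [MeasurableSpace Ω] (P Q : Measure Ω)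
    [IsProbabilityMeasure P] [IsProbabilityMeasure Q] {f : Ω → ℝ} (hfP : Integrable f P)
    (hfR : Integrable (fun ω => Real.exp (f ω)) Q) (hone : ∫ ω, Real.exp (f ω) ∂Q = 1) :
    ((klDiv P Q : ENNReal) : EReal) =
      ((klDiv P (Q.tilted f) : ENNReal) : EReal) + ((∫ ω, f ω ∂P : ℝ) : EReal) := by
  have := isProbabilityMeasure_tilted hfR
  by_cases hac : P ≪ Q
  swap
  · rw [klDiv_of_not_ac hac, klDiv_of_not_ac
      fun h => hac (h.trans (tilted_absolutelyContinuous Q f)), EReal.coe_ennreal_top,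
      EReal.top_add_coe]
  have hac' : P ≪ Q.tilted f := hac.trans (absolutelyContinuous_tilted hfR)
  by_cases hint : Integrable (llr P Q) P
  · have hint' := integrable_llr_tilted_right hac hfP hint hfR
    rw [← EReal.coe_ennreal_toReal (klDiv_ne_top hac hint),
      ← EReal.coe_ennreal_toReal (klDiv_ne_top hac' hint'),
      toReal_klDiv_of_measure_eq hac (by simp), toReal_klDiv_of_measure_eq hac' (by simp),
      integral_llr_tilted_right hac hfP hfR hint, hone, Real.log_one, ← EReal.coe_add]
    congr 1
    ring
  · have hint' : ¬ Integrable (llr P (Q.tilted f)) P := by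
      intro h
      refine hint ((h.add hfP).congr ?_)
      filter_upwards [llr_tilted_right hac hfR] with ω hω
      rw [Pi.add_apply, hω, hone, Real.log_one]
      ring
    rw [klDiv_of_not_integrable hint, klDiv_of_not_integrable hint', EReal.coe_ennreal_top,
      EReal.top_add_coe]

/-! ### The Gibbs path measure and its variational identity -/

section Endpoint

variable {X : Type*}

theorem endpointReweight_eq (P : Measure (PathSpace X)) {φ : X → ℝ} (hφ : ∀ x, 0 ≤ φ x)
    (ψ : X → ℝ) :
    endpointReweight P φ ψ =
      P.withDensity fun ω => ENNReal.ofReal (φ (pos 0 ω) * ψ (pos 1 ω)) := by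
  rw [endpointReweight, ← withDensity_mul _ (measurable_comp_pos 0 φ).ennreal_ofReal
    (measurable_comp_pos 1 ψ).ennreal_ofReal]
  congr 1
  ext ω
  rw [Pi.mul_apply, ENNReal.ofReal_mul (hφ _)]

theorem real_mul_trans01 (P : Measure (PathSpace X)) [IsFiniteMeasure P] (x y : X) :
    P.real (at_ 0 y) * trans01 P x y = P.real (at_ 0 y ∩ at_ 1 x) := by
  rw [trans01, measureReal_def (cond P _), cond_apply (measurableSet_at 0 y), ENNReal.toReal_mul,
    ENNReal.toReal_inv, ← measureReal_def, ← measureReal_def]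
  by_cases h : P.real (at_ 0 y) = 0
  · rw [h, zero_mul]
    exact (le_antisymm ((measureReal_mono inter_subset_left).trans h.le) measureReal_nonneg).symm
  · rw [mul_inv_cancel_left₀ h]

variable [Fintype X]

theorem real_endpointReweight_endpoints (P : Measure (PathSpace X)) [IsFiniteMeasure P]
    {φ ψ : X → ℝ} (hφ : ∀ x, 0 ≤ φ x) (hψ : ∀ x, 0 < ψ x) (x w : X) :
    (endpointReweight P φ ψ).real (at_ 0 x ∩ at_ 1 w) =
      φ x * ψ w * P.real (at_ 0 x ∩ at_ 1 w) := by
  have := isFiniteMeasure_withDensity_pos P 0 φ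
  have hB := (measurableSet_at 0 x).inter (measurableSet_at 1 w)
  rw [endpointReweight, real_withDensity_pos _ _ _ (fun x => (hψ x).le) hB,
    Finset.sum_eq_single w, inter_assoc, inter_self, real_withDensity_pos _ _ _ hφ hB,
    Finset.sum_eq_single x, inter_right_comm, inter_self]
  · ring
  · intro y _ hy
    rw [inter_right_comm, at_inter_at_of_ne hy.symm, empty_inter, measureReal_empty, mul_zero]
  · simp
  · intro y _ hy
    rw [inter_assoc, at_inter_at_of_ne hy.symm, inter_empty, measureReal_empty, mul_zero]
  · simp

theorem integrable_comp_pos (P : Measure (PathSpace X)) [IsFiniteMeasure P] (t : ℝ)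
    (φ : X → ℝ) : Integrable (fun ω => φ (pos t ω)) P := by
  refine Integrable.of_bound (measurable_comp_pos t φ).aestronglyMeasurable (∑ x, |φ x|)
    (Eventually.of_forall fun ω => ?_)
  exact Finset.single_le_sum (f := fun x => |φ x|) (fun x _ => abs_nonneg _)
    (Finset.mem_univ (pos t ω))

variable {mu : X → ℝ} {r : ℝ → X → X → ℝ} {Pr : Measure (PathSpace X)}

theorem partitionFn_nonneg (Pr : Measure (PathSpace X)) (g : X → ℝ) (y : X) :
    0 ≤ partitionFn Pr g y :=
  Finset.sum_nonneg fun _ _ => mul_nonneg measureReal_nonneg (Real.exp_pos _).le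

theorem mul_partitionFn (hPr : IsCTMC mu r Pr) (g : X → ℝ) (y : X) :
    mu y * partitionFn Pr g y = ∑ x, Real.exp (-g x) * Pr.real (at_ 0 y ∩ at_ 1 x) := by
  have := hPr.isProbabilityMeasure
  rw [partitionFn, Finset.mul_sum]
  refine Finset.sum_congr rfl fun x _ => ?_
  rw [← real_mul_trans01, hPr.initial]
  ring

theorem partitionFn_pos (hPr : IsCTMC mu r Pr) (g : X → ℝ) {y : X} (hy : mu y ≠ 0) :
    0 < partitionFn Pr g y := by
  have := hPr.isProbabilityMeasure
  refine lt_of_le_of_ne (partitionFn_nonneg Pr g y) fun h0 => hy ?_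
  have h1 := mul_partitionFn hPr g y
  rw [← h0, mul_zero, eq_comm, Finset.sum_eq_zero_iff_of_nonneg
    fun x _ => mul_nonneg (Real.exp_pos _).le measureReal_nonneg] at h1
  rw [← hPr.initial, ← sum_real_inter_at Pr (at_ 0 y) 1]
  exact Finset.sum_eq_zero fun x hx => (mul_eq_zero.1 (h1 x hx)).resolve_left (Real.exp_pos _).ne'

/-- The path measure with density `e^{-g(X_1)} / Z(X_0)` with respect to the reference measure. -/
noncomputable def gibbs (Pr : Measure (PathSpace X)) (g : X → ℝ) : Measure (PathSpace X) :=
  endpointReweight Pr (fun y => (partitionFn Pr g y)⁻¹) fun x => Real.exp (-g x)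

theorem gibbs_eq (Pr : Measure (PathSpace X)) (g : X → ℝ) :
    gibbs Pr g = Pr.withDensity fun ω =>
      ENNReal.ofReal (Real.exp (-g (pos 1 ω)) / partitionFn Pr g (pos 0 ω)) := by
  rw [gibbs, endpointReweight_eq Pr fun x => inv_nonneg.2 (partitionFn_nonneg Pr g x)]
  simp only [div_eq_inv_mul]

theorem isFiniteMeasure_gibbs (Pr : Measure (PathSpace X)) [IsFiniteMeasure Pr] (g : X → ℝ) :
    IsFiniteMeasure (gibbs Pr g) := by
  have := isFiniteMeasure_withDensity_pos Pr 0 fun y => (partitionFn Pr g y)⁻¹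
  exact isFiniteMeasure_withDensity_pos _ 1 fun x => Real.exp (-g x)

theorem real_gibbs_endpoints (Pr : Measure (PathSpace X)) [IsFiniteMeasure Pr] (g : X → ℝ)
    (x w : X) :
    (gibbs Pr g).real (at_ 0 x ∩ at_ 1 w) =
      (partitionFn Pr g x)⁻¹ * Real.exp (-g w) * Pr.real (at_ 0 x ∩ at_ 1 w) :=
  real_endpointReweight_endpoints Pr (fun x => inv_nonneg.2 (partitionFn_nonneg Pr g x))
    (fun _ => Real.exp_pos _) x w

theorem real_gibbs_initial (hPr : IsCTMC mu r Pr) (g : X → ℝ) (x : X) :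
    (gibbs Pr g).real (at_ 0 x) = mu x := by
  have := hPr.isProbabilityMeasure
  have := isFiniteMeasure_gibbs Pr g
  rw [← sum_real_inter_at _ _ 1]
  simp only [real_gibbs_endpoints, mul_assoc]
  rw [← Finset.mul_sum, ← mul_partitionFn hPr]
  by_cases hx : mu x = 0
  · simp [hx]
  · rw [mul_comm (mu x), inv_mul_cancel_left₀ (partitionFn_pos hPr g hx).ne']

theorem real_gibbs_terminal (hPr : IsCTMC mu r Pr) (g : X → ℝ) (x : X) :
    (gibbs Pr g).real (at_ 1 x) = terminalLaw mu Pr g x := by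
  have := hPr.isProbabilityMeasure
  have := isFiniteMeasure_gibbs Pr g
  rw [← sum_real_inter_at _ _ 0, terminalLaw, Finset.mul_sum]
  refine Finset.sum_congr rfl fun y _ => ?_
  rw [inter_comm, real_gibbs_endpoints, ← real_mul_trans01, hPr.initial]
  ring

theorem exists_isCTMC_gibbs (hPr : IsCTMC mu r Pr) (hmu : ∑ x, mu x = 1)
    (hr : ∀ x y, IntegrableOn (fun t => r t y x) (Icc (0 : ℝ) 1)) (g : X → ℝ) :
    ∃ u, IsCTMC mu u (gibbs Pr g) :=
  exists_isCTMC_endpointReweight hPr hmu hr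
    (fun x => inv_nonneg.2 (partitionFn_nonneg Pr g x)) (fun _ => Real.exp_pos _)
    (real_gibbs_initial hPr g)

theorem isProbabilityMeasure_gibbs (hPr : IsCTMC mu r Pr) (hmu : ∑ x, mu x = 1) (g : X → ℝ) :
    IsProbabilityMeasure (gibbs Pr g) := by
  have := hPr.isProbabilityMeasure
  have := isFiniteMeasure_gibbs Pr g
  constructor
  have h1 := sum_real_inter_at (gibbs Pr g) univ 0
  simp only [univ_inter, real_gibbs_initial hPr, hmu] at h1
  rwa [eq_comm, measureReal_def, ENNReal.toReal_eq_one_iff] at h1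

theorem terminalLaw_mem_stdSimplex (hPr : IsCTMC mu r Pr) (hmu : ∑ x, mu x = 1) (g : X → ℝ) :
    terminalLaw mu Pr g ∈ stdSimplex ℝ X := by
  have := isProbabilityMeasure_gibbs hPr hmu g
  refine ⟨fun x => ?_, ?_⟩
  · rw [← real_gibbs_terminal hPr]
    exact measureReal_nonneg
  · simp only [← real_gibbs_terminal hPr]
    simpa using sum_real_inter_at (gibbs Pr g) univ 1

/-- The Gibbs variational identity for path measures with initial distribution `mu`. -/
theorem klDiv_eq_klDiv_gibbs_add (hPr : IsCTMC mu r Pr) (hmu : ∑ x, mu x = 1) (g : X → ℝ)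
    (P : Measure (PathSpace X)) [IsProbabilityMeasure P] (hP : ∀ x, P.real (at_ 0 x) = mu x) :
    ((klDiv P Pr : ENNReal) : EReal) = ((klDiv P (gibbs Pr g) : ENNReal) : EReal) +
      ((-(∑ y, Real.log (partitionFn Pr g y) * mu y) - ∫ ω, g (pos 1 ω) ∂P : ℝ) : EReal) := by
  have := hPr.isProbabilityMeasure
  have hgp := isProbabilityMeasure_gibbs hPr hmu g
  let f : PathSpace X → ℝ := fun ω => -Real.log (partitionFn Pr g (pos 0 ω)) - g (pos 1 ω)
  have hae : ∀ᵐ ω ∂Pr, Real.exp (f ω) =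
      Real.exp (-g (pos 1 ω)) / partitionFn Pr g (pos 0 ω) := by
    -- `partitionFn` may vanish at starting points of `mu`-mass zero, where its logarithm is a
    -- default value; such starts are `Pr`-null.
    have h0 : ∀ y, ∀ᵐ ω ∂Pr, pos 0 ω = y → mu y ≠ 0 := by
      intro y
      by_cases hy : mu y = 0
      · have h1 : Pr (at_ 0 y) = 0 := by
          rw [← measureReal_eq_zero_iff, hPr.initial, hy]
        filter_upwards [measure_eq_zero_iff_ae_notMem.1 h1] with ω hω h using absurd h hω
      · exact Eventually.of_forall fun _ _ => hy
    filter_upwards [eventually_all.2 h0] with ω hω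
    rw [show f ω = -g (pos 1 ω) - Real.log (partitionFn Pr g (pos 0 ω)) by simp only [f]; ring,
      Real.exp_sub, Real.exp_log (partitionFn_pos hPr g (hω _ rfl))]
  have hfm : Measurable f :=
    (measurable_comp_pos 0 fun y => -Real.log (partitionFn Pr g y)).sub (measurable_comp_pos 1 g)
  have hfP : Integrable f P :=
    (integrable_comp_pos P 0 fun y => -Real.log (partitionFn Pr g y)).sub (integrable_comp_pos P 1 g)
  have hlin : ∫⁻ ω, ENNReal.ofReal (Real.exp (f ω)) ∂Pr = 1 := by
    rw [← hgp.measure_univ, gibbs_eq, withDensity_apply _ MeasurableSet.univ,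
      Measure.restrict_univ]
    refine lintegral_congr_ae ?_
    filter_upwards [hae] with ω hω
    rw [hω]
  have hfR : Integrable (fun ω => Real.exp (f ω)) Pr := by
    rw [← lintegral_ofReal_ne_top_iff_integrable hfm.exp.aestronglyMeasurable
      (Eventually.of_forall fun ω => (Real.exp_pos _).le), hlin]
    exact ENNReal.one_ne_top
  have hone : ∫ ω, Real.exp (f ω) ∂Pr = 1 := by
    rw [integral_eq_lintegral_of_nonneg_ae (Eventually.of_forall fun ω => (Real.exp_pos _).le)
      hfm.exp.aestronglyMeasurable, hlin, ENNReal.toReal_one]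
  have htilt : Pr.tilted f = gibbs Pr g := by
    rw [gibbs_eq, Measure.tilted]
    refine withDensity_congr_ae ?_
    filter_upwards [hae] with ω hω
    rw [hone, div_one, hω]
  -- The `log Z` term sees `P` only through its initial law, so it is the same constant for all
  -- competitors.
  have hf : ∫ ω, f ω ∂P =
      -(∑ y, Real.log (partitionFn Pr g y) * mu y) - ∫ ω, g (pos 1 ω) ∂P := by
    have h1 := integral_comp_pos P 0 fun y => -Real.log (partitionFn Pr g y)
    simp only [hP, neg_mul, Finset.sum_neg_distrib] at h1
    rw [← h1]
    exact integral_sub (integrable_comp_pos P 0 fun y => -Real.log (partitionFn Pr g y))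
      (integrable_comp_pos P 1 g)
  rw [klDiv_eq_klDiv_tilted_add P Pr hfP hfR hone, htilt, hf]

/-! ### Minimizers of the two problems -/

theorem coe_klDiv_add_le_iff {Ω : Type*} [MeasurableSpace Ω] {P P' Q Q' : Measure Ω} (c : ℝ) :
    ((klDiv P Q : ENNReal) : EReal) + (c : EReal) ≤ ((klDiv P' Q' : ENNReal) : EReal) + (c : EReal) ↔
      klDiv P Q ≤ klDiv P' Q' := by
  rw [← EReal.coe_ennreal_le_coe_ennreal_iff]
  refine ⟨fun h => ?_, fun h => add_le_add_left h _⟩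
  have := add_le_add_left h ((-c : ℝ) : EReal)
  simpa only [add_assoc, ← EReal.coe_add, add_neg_cancel, EReal.coe_zero, add_zero] using this

/-- The terminal cost cancels the same term in the variational identity, so the objective is the
divergence from `gibbs` plus a constant; `gibbs` is a competitor and attains divergence zero. -/
theorem solvesSOC_iff (hPr : IsCTMC mu r Pr) (hmu : ∑ x, mu x = 1)
    (hr : ∀ x y, IntegrableOn (fun t => r t y x) (Icc (0 : ℝ) 1)) (g : X → ℝ)
    (u : ℝ → X → X → ℝ) (P : Measure (PathSpace X)) :
    SolvesSOC mu Pr g u P ↔ IsCTMC mu u P ∧ P = gibbs Pr g := by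
  have hgp := isProbabilityMeasure_gibbs hPr hmu g
  obtain ⟨u₀, hu₀⟩ := exists_isCTMC_gibbs hPr hmu hr g
  have hcost : ∀ u' P', IsCTMC mu u' P' → socCost Pr g P' =
      ((klDiv P' (gibbs Pr g) : ENNReal) : EReal) +
        ((-(∑ y, Real.log (partitionFn Pr g y) * mu y) : ℝ) : EReal) := by
    intro u' P' h'
    have := h'.isProbabilityMeasure
    rw [socCost, klDiv_eq_klDiv_gibbs_add hPr hmu g P' h'.initial, add_assoc, ← EReal.coe_add,
      sub_add_cancel]
  constructor
  · rintro ⟨hP, hmin⟩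
    have := hP.isProbabilityMeasure
    have h1 := hmin u₀ _ hu₀
    rw [hcost u P hP, hcost u₀ _ hu₀, coe_klDiv_add_le_iff, klDiv_self, nonpos_iff_eq_zero,
      klDiv_eq_zero_iff] at h1
    exact ⟨hP, h1⟩
  · rintro ⟨hP, rfl⟩
    refine ⟨hP, fun u' P' h' => ?_⟩
    rw [hcost u _ hP, hcost u' P' h', coe_klDiv_add_le_iff, klDiv_self]
    exact zero_le

/-- The terminal constraint fixes the expectation of `g`, so among feasible controls the objective
again differs from the divergence from `gibbs` by a constant. -/
theorem solvesSB_iff (hPr : IsCTMC mu r Pr) (hmu : ∑ x, mu x = 1)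
    (hr : ∀ x y, IntegrableOn (fun t => r t y x) (Icc (0 : ℝ) 1)) (g : X → ℝ)
    (u : ℝ → X → X → ℝ) (P : Measure (PathSpace X)) :
    SolvesSB mu Pr (terminalLaw mu Pr g) u P ↔ IsCTMC mu u P ∧ P = gibbs Pr g := by
  have hgp := isProbabilityMeasure_gibbs hPr hmu g
  obtain ⟨u₀, hu₀⟩ := exists_isCTMC_gibbs hPr hmu hr g
  have hkl : ∀ u' P', IsCTMC mu u' P' → (∀ x, P'.real (at_ 1 x) = terminalLaw mu Pr g x) →
      ((klDiv P' Pr : ENNReal) : EReal) = ((klDiv P' (gibbs Pr g) : ENNReal) : EReal) +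
        ((-(∑ y, Real.log (partitionFn Pr g y) * mu y) -
          ∑ x, g x * terminalLaw mu Pr g x : ℝ) : EReal) := by
    intro u' P' h' ht
    have := h'.isProbabilityMeasure
    rw [klDiv_eq_klDiv_gibbs_add hPr hmu g P' h'.initial, integral_comp_pos]
    simp only [ht]
  constructor
  · rintro ⟨hP, ht, hmin⟩
    have := hP.isProbabilityMeasure
    have h1 := hmin u₀ _ hu₀ (real_gibbs_terminal hPr g)
    rw [← EReal.coe_ennreal_le_coe_ennreal_iff, hkl u P hP ht,
      hkl u₀ _ hu₀ (real_gibbs_terminal hPr g), coe_klDiv_add_le_iff, klDiv_self,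
      nonpos_iff_eq_zero, klDiv_eq_zero_iff] at h1
    exact ⟨hP, h1⟩
  · rintro ⟨hP, rfl⟩
    refine ⟨hP, real_gibbs_terminal hPr g, fun u' P' h' ht' => ?_⟩
    rw [← EReal.coe_ennreal_le_coe_ennreal_iff, hkl u _ hP (real_gibbs_terminal hPr g),
      hkl u' P' h' ht', coe_klDiv_add_le_iff, klDiv_self]
    exact zero_le

end Endpoint

end CTMC

theorem mainTheorem5 {X : Type*} [Fintype X] (mu : X → ℝ) (hmu : mu ∈ stdSimplex ℝ X)
    (r : ℝ → X → X → ℝ)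
    (hr : ∀ x y, MeasureTheory.IntegrableOn (fun t => r t y x) (Set.Icc (0 : ℝ) 1))
    (Pr : MeasureTheory.Measure (CTMC.PathSpace X)) (hPr : CTMC.IsCTMC mu r Pr)
    (g : X → ℝ) :
    CTMC.terminalLaw mu Pr g ∈ stdSimplex ℝ X ∧
    (∀ (u : ℝ → X → X → ℝ) (P : MeasureTheory.Measure (CTMC.PathSpace X)),
      CTMC.SolvesSOC mu Pr g u P ↔ CTMC.SolvesSB mu Pr (CTMC.terminalLaw mu Pr g) u P) ∧
    (∃ (u : ℝ → X → X → ℝ) (P : MeasureTheory.Measure (CTMC.PathSpace X)),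
      CTMC.SolvesSOC mu Pr g u P) ∧
    (∀ (u : ℝ → X → X → ℝ) (P : MeasureTheory.Measure (CTMC.PathSpace X)),
      CTMC.SolvesSOC mu Pr g u P →
        P = Pr.withDensity (fun ω =>
          ENNReal.ofReal (Real.exp (-g (CTMC.pos 1 ω)) /
            CTMC.partitionFn Pr g (CTMC.pos 0 ω)))) := by
  have hmu1 : ∑ x, mu x = 1 := hmu.2
  refine ⟨CTMC.terminalLaw_mem_stdSimplex hPr hmu1 g, fun u P => ?_, ?_, fun u P h => ?_⟩
  · rw [CTMC.solvesSOC_iff hPr hmu1 hr, CTMC.solvesSB_iff hPr hmu1 hr]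
  · obtain ⟨u, hu⟩ := CTMC.exists_isCTMC_gibbs hPr hmu1 hr g
    exact ⟨u, CTMC.gibbs Pr g, (CTMC.solvesSOC_iff hPr hmu1 hr g u _).2 ⟨hu, rfl⟩⟩
  · rw [← CTMC.gibbs_eq]
    exact ((CTMC.solvesSOC_iff hPr hmu1 hr g u P).1 h).2
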